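/- Let $V$ be a finite-dimensional real vector space and let $(A_1,B_1),\dots,(A_m,B_m)$ be pairs of non-trivial (that is, nonzero) linear subspaces of $V$. Write $a_i=\dim A_i$ and $b_i=\dim B_i$ for $1\le i\le m$. Suppose that (i) $A_i\cap B_i=\{0\}$ for $1\le i\le m$; (ii) $A_i\cap B_j\neq\{0\}$ for $1\le i<j\le m$; (iii) $a_1\le a_2\le\dots\le a_m$ and $b_1\ge b_2\ge\dots\ge b_m$. Then $$\sum_{i=1}^m \frac{1}{\binom{a_i+b_i}{a_i}}\le 1.$$ -/

import Mathlib

/-! Let n = dim V, let J be the degree-q part of the ideal of the exterior algebra generated by the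
top forms of a family of the B_j, and fix a basis in general position to all A_i ⊕ B_i. With k = n -
p - q, average over k-subsets S of the basis the dimension of J ∧ b_S, a copy of the image of J in
the q-th exterior power of a (p+q)-dimensional quotient. Dividing by C(p+q, q) gives a density;
`wedgeWeight` is n! times it. A local LYM argument (`sum_finrank_inf_ker_mulRight_le`) shows that it
does not decrease when p decreases or q increases.

Add the B_i in the order i = m, ..., 1, evaluating at (p, q) = (a_i, b_i); by (iii), each move
between these points is of the monotone kind. At stage i the top form of A_i kills the ideal built
from the B_j with j > i, but not the top form of B_i times b_S. So every dimension grows by at least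
1 and the density by at least 1/C(a_i+b_i, a_i). At (0, n) the density is at most 1. -/

open Module

/-! ### Bases in general position -/

section GeneralPosition

variable {K V : Type*} [Field K] [Infinite K] [AddCommGroup V] [Module K V]

/-- A vector avoiding finitely many proper subspaces. -/
theorem exists_forall_notMem_of_ne_top (s : Finset (Submodule K V)) (hs : ∀ p ∈ s, p ≠ ⊤) :
    ∃ x : V, ∀ p ∈ s, x ∉ p := by
  have h := Subspace.biUnion_ne_univ_of_top_notMem (s := s) (fun h => hs ⊤ h rfl)
  obtain ⟨x, hx⟩ := (Set.ne_univ_iff_exists_notMem _).1 h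
  exact ⟨x, fun p hp hxp => hx (Set.mem_biUnion hp hxp)⟩

variable [FiniteDimensional K V]

theorem exists_finset_generalPosition {ι : Type*} [Finite ι] (W : ι → Submodule K V) (i₀ : ι)
    (hi₀ : W i₀ = ⊥) (k : ℕ) (hk : k ≤ finrank K V) :
    ∃ F : Finset V, F.card = k ∧ ∀ i, ∀ S ⊆ F,
      min (finrank K V) (finrank K (W i) + S.card) ≤
        finrank K ↥(W i ⊔ Submodule.span K (S : Set V)) := by
  classical
  have := Fintype.ofFinite ι
  induction k with
  | zero =>
    refine ⟨∅, rfl, fun i S hS => ?_⟩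
    obtain rfl := Finset.subset_empty.1 hS
    rw [Finset.card_empty, add_zero]
    exact (min_le_right _ _).trans (Submodule.finrank_mono le_sup_left)
  | succ k ih =>
    obtain ⟨F, hF, h⟩ := ih (by omega)
    -- The new vector avoids every proper subspace spanned by some `W i` and a subset of `F`, so it
    -- raises the dimension of each of them.
    obtain ⟨x, hx⟩ := exists_forall_notMem_of_ne_top
      (((Finset.univ ×ˢ F.powerset).image
        (fun y : ι × Finset V => W y.1 ⊔ Submodule.span K (y.2 : Set V))).filter (· ≠ ⊤))
      (by simp)
    have hx' : ∀ i, ∀ S ⊆ F, W i ⊔ Submodule.span K (S : Set V) ≠ ⊤ →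
        x ∉ W i ⊔ Submodule.span K (S : Set V) := by
      intro i S hS hne
      refine hx _ (Finset.mem_filter.2 ⟨Finset.mem_image.2 ⟨(i, S), ?_, rfl⟩, hne⟩)
      simpa using hS
    have hxF : x ∉ F := by
      intro hxF
      refine hx' i₀ F subset_rfl ?_ (Submodule.mem_sup_right (Submodule.subset_span hxF))
      rw [hi₀, bot_sup_eq]
      intro htop
      have := finrank_span_finset_le_card (R := K) F
      rw [Set.finrank, htop, finrank_top] at this
      omega
    refine ⟨insert x F, by rw [Finset.card_insert_of_notMem hxF, hF], fun i S hS => ?_⟩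
    by_cases hxS : x ∈ S
    · have hS' : S.erase x ⊆ F := by
        rwa [Finset.subset_insert_iff] at hS
      have hcard : (S.erase x).card + 1 = S.card := Finset.card_erase_add_one hxS
      have hle : W i ⊔ Submodule.span K (S.erase x : Set V) ≤
          W i ⊔ Submodule.span K (S : Set V) :=
        sup_le_sup_left (Submodule.span_mono (by simp)) _
      by_cases htop : W i ⊔ Submodule.span K (S.erase x : Set V) = ⊤
      · rw [htop, top_le_iff] at hle
        rw [hle, finrank_top]
        exact min_le_left _ _
      · have hlt : W i ⊔ Submodule.span K (S.erase x : Set V) <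
            W i ⊔ Submodule.span K (S : Set V) := by
          refine lt_of_le_of_ne hle fun heq => hx' i _ hS' htop ?_
          rw [heq]
          exact Submodule.mem_sup_right (Submodule.subset_span hxS)
        have h1 := Submodule.finrank_lt_finrank_of_lt hlt
        have h2 := h i _ hS'
        omega
    · exact h i S fun y hy => (Finset.mem_insert.1 (hS hy)).resolve_left
        fun hyx => hxS (hyx ▸ hy)

/-- A basis in general position with respect to finitely many subspaces. -/
theorem exists_basis_generalPosition {ι : Type*} [Finite ι] (W : ι → Submodule K V) :
    ∃ b : Basis (Fin (finrank K V)) K V, ∀ i, ∀ S : Finset (Fin (finrank K V)),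
      finrank K (W i) + S.card = finrank K V → W i ⊔ Submodule.span K (b '' S) = ⊤ := by
  classical
  obtain ⟨F, hF, h⟩ := exists_finset_generalPosition
    -- The extra member `⊥` forces the chosen vectors themselves to span `V`.
    (fun o : Option ι => o.elim ⊥ W) none rfl _ le_rfl
  have hspan : ⊤ ≤ Submodule.span K (F : Set V) := by
    have : min (finrank K V) (finrank K (⊥ : Submodule K V) + F.card) ≤
        finrank K ↥(⊥ ⊔ Submodule.span K (F : Set V)) := h none F subset_rfl
    rw [finrank_bot, zero_add, hF, min_self, bot_sup_eq] at this
    exact (Submodule.eq_top_of_finrank_eq (le_antisymm (Submodule.finrank_le _) this)).ge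
  let v : Fin (finrank K V) → V := fun j => (F.equivFinOfCardEq hF).symm j
  have hv : Set.range v = F := by
    ext x
    constructor
    · rintro ⟨j, rfl⟩
      exact ((F.equivFinOfCardEq hF).symm j).2
    · intro hx
      exact ⟨F.equivFinOfCardEq hF ⟨x, hx⟩, by simp [v]⟩
  have hinj : Function.Injective v :=
    Subtype.val_injective.comp (F.equivFinOfCardEq hF).symm.injective
  refine ⟨basisOfTopLeSpanOfCardEqFinrank v (by rwa [hv]) (by simp), fun i S hS => ?_⟩
  have : min (finrank K V) (finrank K (W i) + (S.image v).card) ≤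
      finrank K ↥(W i ⊔ Submodule.span K (S.image v : Set V)) := h (some i) (S.image v) (by
    rw [← Finset.coe_subset, ← hv, Finset.coe_image]
    exact Set.image_subset_range _ _)
  rw [Finset.card_image_of_injective _ hinj, hS, min_self, Finset.coe_image] at this
  rw [coe_basisOfTopLeSpanOfCardEqFinrank]
  exact Submodule.eq_top_of_finrank_eq (le_antisymm (Submodule.finrank_le _) this)

end GeneralPosition

/-! ### Subspaces and coordinates -/

section Coordinates

variable {K E X : Type*} [Field K] [AddCommGroup E] [Module K E] [Finite X]

/-- A subspace is determined by as many coordinates as its dimension. -/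
theorem exists_finset_coord_injective (B : Basis X K E) (Z : Submodule K E) :
    ∃ F : Finset X, F.card = finrank K Z ∧
      (∀ t ∈ F, ∃ z ∈ Z, B.repr z t ≠ 0) ∧
      ∀ z ∈ Z, (∀ t ∈ F, B.repr z t = 0) → z = 0 := by
  classical
  have := Fintype.ofFinite X
  have : FiniteDimensional K E := Module.Finite.of_basis B
  let f : X → Dual K Z := fun t => (B.coord t).comp Z.subtype
  obtain ⟨κ, a, ha, hspan, hli⟩ := exists_linearIndependent' K f
  have : Finite κ := Finite.of_injective a ha
  have := Fintype.ofFinite κ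
  have hzero : ∀ z : Z, (∀ k, f (a k) z = 0) → z = 0 := by
    intro z hz
    have h1 : Submodule.span K (Set.range (f ∘ a)) ≤ LinearMap.ker (Dual.eval K Z z) := by
      rw [Submodule.span_le]
      rintro _ ⟨k, rfl⟩
      exact hz k
    rw [hspan] at h1
    apply Subtype.ext
    apply B.ext_elem
    intro t
    have h2 := h1 (Submodule.subset_span ⟨t, rfl⟩)
    simpa [f] using h2
  have hcard : Fintype.card κ = finrank K Z := by
    apply le_antisymm
    · rw [← Subspace.dual_finrank_eq (K := K) (V := Z)]
      exact hli.fintype_card_le_finrank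
    · have hinj : Function.Injective (LinearMap.pi fun k => f (a k)) := by
        rw [← LinearMap.ker_eq_bot, LinearMap.ker_eq_bot']
        intro z hz
        exact hzero z fun k => congrFun hz k
      simpa using LinearMap.finrank_le_finrank_of_injective hinj
  refine ⟨Finset.univ.image a, ?_, ?_, ?_⟩
  · rw [Finset.card_image_of_injective _ ha, Finset.card_univ, hcard]
  · intro t ht
    obtain ⟨k, -, rfl⟩ := Finset.mem_image.1 ht
    by_contra! hcon
    exact hli.ne_zero k (LinearMap.ext fun z => hcon z z.2)
  · intro z hz h
    have := hzero ⟨z, hz⟩ fun k => h _ (Finset.mem_image_of_mem _ (Finset.mem_univ k))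
    simpa using this

theorem finrank_le_card_of_coord_injective {Z : Submodule K E} [FiniteDimensional K Z]
    (B : Basis X K E) (F : Finset X)
    (h : ∀ z ∈ Z, (∀ t ∈ F, B.repr z t = 0) → z = 0) : finrank K Z ≤ F.card := by
  have hinj : Function.Injective
      (LinearMap.pi fun t : F => (B.coord (t : X)).comp Z.subtype) := by
    rw [← LinearMap.ker_eq_bot, LinearMap.ker_eq_bot']
    intro z hz
    exact Subtype.ext (h z z.2 fun t ht => congrFun hz ⟨t, ht⟩)
  simpa using LinearMap.finrank_le_finrank_of_injective hinj

end Coordinates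

/-! ### Products of exterior monomials -/

section ExteriorBasis

variable {K V I : Type*} [Field K] [AddCommGroup V] [Module K V] [LinearOrder I]
  (b : Basis I K V)

open Set.powersetCard in
theorem exteriorAlgebra_basis_mul_of_not_disjoint {S T : Finset I} (h : ¬ Disjoint S T) :
    b.ExteriorAlgebra S * b.ExteriorAlgebra T = 0 :=
  ExteriorAlgebra.basis_mul_of_not_disjoint b (ofCard (s := S) rfl) (ofCard (s := T) rfl) h

open Set.powersetCard in
theorem exteriorAlgebra_basis_mul_of_disjoint {S T : Finset I} (h : Disjoint S T) :
    ∃ c : K, c ≠ 0 ∧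
      b.ExteriorAlgebra S * b.ExteriorAlgebra T = c • b.ExteriorAlgebra (S ∪ T) := by
  have h1 := ExteriorAlgebra.basis_mul_of_disjoint b (ofCard (s := S) rfl) (ofCard (s := T) rfl) h
  have h2 : ((disjUnion (s := ofCard (s := S) rfl) (t := ofCard (s := T) rfl) h :
      Set.powersetCard I _) : Finset I) = S ∪ T := by
    simp [disjUnion]
  rw [h2] at h1
  refine ⟨((Equiv.Perm.sign (permOfDisjoint (s := ofCard (s := S) rfl)
    (t := ofCard (s := T) rfl) h) : ℤ) : K), ?_, ?_⟩
  · rcases Int.units_eq_one_or (Equiv.Perm.sign (permOfDisjoint (s := ofCard (s := S) rfl)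
      (t := ofCard (s := T) rfl) h)) with h | h <;> rw [h] <;> simp
  · rw [Int.cast_smul_eq_zsmul]
    exact h1

end ExteriorBasis

/-! ### Local counting inequality and multiplication by monomials -/

section Wedge

variable {K V I : Type*} [Field K] [AddCommGroup V] [Module K V] [LinearOrder I]
  (b : Basis I K V)

theorem exteriorAlgebra_repr_eq_zero_of_mul_eq_zero {x : ExteriorAlgebra K V} {i : I}
    (hx : x * b.ExteriorAlgebra {i} = 0) {T : Finset I} (hT : i ∉ T) :
    b.ExteriorAlgebra.repr x T = 0 := by
  classical
  obtain ⟨c, hc, hmul⟩ := exteriorAlgebra_basis_mul_of_disjoint b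
    (Finset.disjoint_singleton_right.2 hT)
  -- Among monomials, only the one indexed by `T` contributes to the coefficient at `T ∪ {i}` after
  -- multiplication by `b i`.
  have key : (b.ExteriorAlgebra.coord (T ∪ {i})).comp
      (LinearMap.mulRight K (b.ExteriorAlgebra {i})) = c • b.ExteriorAlgebra.coord T := by
    refine b.ExteriorAlgebra.ext fun T' => ?_
    simp only [LinearMap.comp_apply, LinearMap.mulRight_apply, LinearMap.smul_apply,
      Basis.coord_apply, Basis.repr_self]
    by_cases hTT : T' = T
    · subst hTT
      rw [hmul]
      simp
    · rw [Finsupp.single_eq_of_ne (Ne.symm hTT), smul_zero]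
      by_cases hi : i ∈ T'
      · rw [exteriorAlgebra_basis_mul_of_not_disjoint b (by simpa using hi)]
        simp
      · obtain ⟨c', -, hmul'⟩ := exteriorAlgebra_basis_mul_of_disjoint b
          (Finset.disjoint_singleton_right.2 hi)
        rw [hmul', map_smul, Basis.repr_self, Finsupp.smul_apply, Finsupp.single_eq_of_ne,
          smul_zero]
        intro h
        apply hTT
        have := congrArg (fun U => U.erase i) h
        simpa [Finset.union_comm _ {i}, ← Finset.insert_eq, hi, hT] using this.symm
  have := LinearMap.congr_fun key x
  simp only [LinearMap.comp_apply, LinearMap.mulRight_apply, hx, map_zero, LinearMap.smul_apply,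
    Basis.coord_apply, smul_eq_mul] at this
  exact (mul_eq_zero.1 this.symm).resolve_left hc

/-- Choose dim `Z` index sets whose coordinates determine `Z`. Elements killed by `b i` are
supported on sets containing `i`, so the i-th dimension is at most the number of chosen sets
containing `i`. Double counting finishes, since each chosen set has at most `q` elements outside
`S`. -/
theorem sum_finrank_inf_ker_mulRight_le [Fintype I] (Z : Submodule K (ExteriorAlgebra K V))
    (S : Finset I) (q : ℕ)
    (hZ : ∀ z ∈ Z, ∀ T, b.ExteriorAlgebra.repr z T ≠ 0 → (T \ S).card ≤ q) :
    ∑ i ∈ Sᶜ, finrank K ↥(Z ⊓ LinearMap.ker (LinearMap.mulRight K (b.ExteriorAlgebra {i}))) ≤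
      q * finrank K Z := by
  classical
  have : FiniteDimensional K (ExteriorAlgebra K V) := Module.Finite.of_basis b.ExteriorAlgebra
  obtain ⟨F, hF, hsupp, hinj⟩ := exists_finset_coord_injective b.ExteriorAlgebra Z
  calc _ ≤ ∑ i ∈ Sᶜ, (F.filter (i ∈ ·)).card := by
        refine Finset.sum_le_sum fun i _ => ?_
        refine finrank_le_card_of_coord_injective b.ExteriorAlgebra _ fun z hz h => ?_
        refine hinj z hz.1 fun T hT => ?_
        by_cases hi : i ∈ T
        · exact h T (Finset.mem_filter.2 ⟨hT, hi⟩)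
        · exact exteriorAlgebra_repr_eq_zero_of_mul_eq_zero b hz.2 hi
    _ = ∑ T ∈ F, (T \ S).card := by
        simp_rw [Finset.card_eq_sum_ones, Finset.sum_filter]
        rw [Finset.sum_comm]
        refine Finset.sum_congr rfl fun T _ => ?_
        rw [← Finset.sum_filter]
        congr 1
        ext i
        simp [and_comm]
    _ ≤ ∑ T ∈ F, q := Finset.sum_le_sum fun T hT => by
        obtain ⟨z, hz, hzT⟩ := hsupp T hT
        exact hZ z hz T hzT
    _ = q * finrank K Z := by rw [Finset.sum_const, hF, smul_eq_mul, mul_comm]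

/-- The image of `J` under right multiplication by the exterior monomial `b_S`. -/
noncomputable def wedgeBasis (J : Submodule K (ExteriorAlgebra K V)) (S : Finset I) :
    Submodule K (ExteriorAlgebra K V) :=
  J.map (LinearMap.mulRight K (b.ExteriorAlgebra S))

theorem wedgeBasis_mono {J J' : Submodule K (ExteriorAlgebra K V)} (h : J ≤ J') (S : Finset I) :
    wedgeBasis b J S ≤ wedgeBasis b J' S :=
  Submodule.map_mono h

theorem exteriorPower_le_span_basis [Fintype I] (q : ℕ) :
    (⋀[K]^q V : Submodule K (ExteriorAlgebra K V)) ≤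
      Submodule.span K (b.ExteriorAlgebra '' {T | T.card = q}) := by
  rw [← exteriorPower.ιMulti_family_span_fixedDegree_of_span K b.span_eq, Submodule.span_le]
  rintro _ ⟨T, rfl⟩
  rw [← ExteriorAlgebra.basis_apply_powersetCard]
  exact Submodule.subset_span ⟨T, T.2, rfl⟩

theorem card_sdiff_le_of_repr_wedgeBasis_ne_zero [Fintype I]
    {J : Submodule K (ExteriorAlgebra K V)} {q : ℕ} (hJ : J ≤ ⋀[K]^q V) {S : Finset I} :
    ∀ z ∈ wedgeBasis b J S, ∀ T, b.ExteriorAlgebra.repr z T ≠ 0 → (T \ S).card ≤ q := by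
  have h : wedgeBasis b J S ≤
      Submodule.span K (b.ExteriorAlgebra '' {T | (T \ S).card ≤ q}) := by
    rw [wedgeBasis, Submodule.map_le_iff_le_comap]
    refine (hJ.trans (exteriorPower_le_span_basis b q)).trans (Submodule.span_le.2 ?_)
    rintro _ ⟨T, hT, rfl⟩
    simp only [SetLike.mem_coe, Submodule.mem_comap, LinearMap.mulRight_apply]
    by_cases hd : Disjoint T S
    · obtain ⟨c, -, hc⟩ := exteriorAlgebra_basis_mul_of_disjoint b hd
      rw [hc]
      refine Submodule.smul_mem _ _ (Submodule.subset_span ⟨_, ?_, rfl⟩)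
      rw [Set.mem_ofPred_eq, Finset.union_sdiff_right]
      exact (Finset.card_le_card Finset.sdiff_subset).trans_eq hT
    · rw [exteriorAlgebra_basis_mul_of_not_disjoint b hd]
      exact zero_mem _
  intro z hz T hT
  have := (b.ExteriorAlgebra.mem_span_image).1 (h hz)
  exact this (Finsupp.mem_support_iff.2 hT)

theorem wedgeBasis_insert (J : Submodule K (ExteriorAlgebra K V)) {S : Finset I} {i : I}
    (hi : i ∉ S) : wedgeBasis b J (insert i S) =
      (wedgeBasis b J S).map (LinearMap.mulRight K (b.ExteriorAlgebra {i})) := by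
  obtain ⟨c, hc, h⟩ := exteriorAlgebra_basis_mul_of_disjoint b
    (Finset.disjoint_singleton_right.2 hi)
  have h2 : (LinearMap.mulRight K (b.ExteriorAlgebra {i})).comp
      (LinearMap.mulRight K (b.ExteriorAlgebra S)) =
      c • LinearMap.mulRight K (b.ExteriorAlgebra (insert i S)) := by
    refine LinearMap.ext fun x => ?_
    simp only [LinearMap.comp_apply, LinearMap.mulRight_apply, LinearMap.smul_apply, mul_assoc, h,
      mul_smul_comm, Finset.union_comm S {i}, ← Finset.insert_eq]
  rw [wedgeBasis, wedgeBasis, ← Submodule.map_comp, h2, Submodule.map_smul _ _ _ hc]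

/-- Up to a nonzero scalar, x ∧ b_{S ∪ i} is (x ∧ b_i) ∧ b_S, and a further factor b_i kills it. -/
theorem wedgeBasis_insert_le {J J' : Submodule K (ExteriorAlgebra K V)}
    (hJ : ∀ x ∈ J, ∀ v, x * ExteriorAlgebra.ι K v ∈ J') {S : Finset I} {i : I} (hi : i ∉ S) :
    wedgeBasis b J (insert i S) ≤
      wedgeBasis b J' S ⊓ LinearMap.ker (LinearMap.mulRight K (b.ExteriorAlgebra {i})) := by
  have hsing : b.ExteriorAlgebra {i} = ExteriorAlgebra.ι K (b i) := by
    rw [ExteriorAlgebra.basis_apply_ofCard (n := 1) b (Finset.card_singleton i),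
      ExteriorAlgebra.ιMulti_family, ExteriorAlgebra.ιMulti_apply]
    have := (Set.powersetCard.mem_range_ofFinEmbEquiv_symm_iff_mem
      (Set.powersetCard.ofCard (n := 1) (Finset.card_singleton i)) _).1 (Set.mem_range_self 0)
    have := Finset.mem_singleton.1 (this : _ ∈ ({i} : Finset I))
    simp [this]
  rintro _ ⟨x, hx, rfl⟩
  refine ⟨?_, ?_⟩
  · obtain ⟨c, hc, h⟩ := exteriorAlgebra_basis_mul_of_disjoint b
      (Finset.disjoint_singleton_left.2 hi)
    rw [← Finset.insert_eq] at h
    refine ⟨c⁻¹ • (x * ExteriorAlgebra.ι K (b i)), Submodule.smul_mem _ _ (hJ x hx _), ?_⟩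
    simp only [LinearMap.mulRight_apply]
    rw [← hsing, smul_mul_assoc, mul_assoc, h, mul_smul_comm, smul_smul, inv_mul_cancel₀ hc,
      one_smul]
  · simp only [SetLike.mem_coe, LinearMap.mem_ker, LinearMap.mulRight_apply, mul_assoc]
    rw [exteriorAlgebra_basis_mul_of_not_disjoint b (by simp), mul_zero]

end Wedge

/-! ### Monotonicity of the summed ranks -/

section Weight

variable {K V I : Type*} [Field K] [AddCommGroup V] [Module K V] [LinearOrder I] [Fintype I]
  (b : Basis I K V)

/-- The sum of the dimensions of `J ∧ b_S` over all `k`-subsets `S` of the basis. -/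
noncomputable def wedgeRank (J : Submodule K (ExteriorAlgebra K V)) (k : ℕ) : ℕ :=
  ∑ S ∈ Finset.univ.powersetCard k, finrank K (wedgeBasis b J S)

theorem sum_powersetCard_succ (f : Finset I → ℕ) (k : ℕ) :
    (k + 1) * ∑ S ∈ Finset.univ.powersetCard (k + 1), f S =
      ∑ S ∈ Finset.univ.powersetCard k, ∑ i ∈ Sᶜ, f (insert i S) := by
  have h1 : (k + 1) * ∑ S ∈ Finset.univ.powersetCard (k + 1), f S =
      ∑ S ∈ Finset.univ.powersetCard (k + 1), ∑ i ∈ S, f S := by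
    rw [Finset.mul_sum]
    refine Finset.sum_congr rfl fun S hS => ?_
    rw [Finset.sum_const, (Finset.mem_powersetCard.1 hS).2, smul_eq_mul]
  rw [h1, Finset.sum_sigma', Finset.sum_sigma']
  refine Finset.sum_bij' (fun x _ => ⟨x.1.erase x.2, x.2⟩) (fun x _ => ⟨insert x.2 x.1, x.2⟩)
    ?_ ?_ ?_ ?_ ?_
  · rintro ⟨S, i⟩ h
    simp only [Finset.mem_sigma, Finset.mem_powersetCard_univ] at h ⊢
    simp [h.2, h.1]
  · rintro ⟨S, i⟩ h
    simp only [Finset.mem_sigma, Finset.mem_powersetCard_univ, Finset.mem_compl] at h ⊢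
    simp [h.2, h.1]
  · rintro ⟨S, i⟩ h
    simp only [Finset.mem_sigma] at h
    simp [h.2]
  · rintro ⟨S, i⟩ h
    simp only [Finset.mem_sigma, Finset.mem_compl] at h
    simp [h.2]
  · rintro ⟨S, i⟩ h
    simp only [Finset.mem_sigma] at h
    simp [h.2]

/-- Projecting along a basis vector does not decrease the average density. -/
theorem wedgeRank_le_wedgeRank_succ {J : Submodule K (ExteriorAlgebra K V)} {p q k : ℕ}
    (hJ : J ≤ ⋀[K]^q V) (hk : p + 1 + q + k = Fintype.card I) :
    (p + 1) * wedgeRank b J k ≤ (k + 1) * wedgeRank b J (k + 1) := by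
  have : FiniteDimensional K (ExteriorAlgebra K V) := Module.Finite.of_basis b.ExteriorAlgebra
  rw [wedgeRank, wedgeRank, sum_powersetCard_succ, Finset.mul_sum]
  refine Finset.sum_le_sum fun S hS => ?_
  have hcard : Sᶜ.card = p + 1 + q := by
    rw [Finset.card_compl, (Finset.mem_powersetCard.1 hS).2]
    omega
  have h := sum_finrank_inf_ker_mulRight_le b (wedgeBasis b J S) S q
    (card_sdiff_le_of_repr_wedgeBasis_ne_zero b hJ)
  have h2 : ∀ i ∈ Sᶜ, finrank K (wedgeBasis b J (insert i S)) + finrank K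
      ↥(wedgeBasis b J S ⊓ LinearMap.ker (LinearMap.mulRight K (b.ExteriorAlgebra {i}))) =
      finrank K (wedgeBasis b J S) := by
    intro i hi
    rw [wedgeBasis_insert b J (Finset.mem_compl.1 hi)]
    have := LinearMap.finrank_range_add_finrank_ker
      ((LinearMap.mulRight K (b.ExteriorAlgebra {i})).domRestrict (wedgeBasis b J S))
    rw [LinearMap.range_domRestrict, LinearMap.ker_domRestrict] at this
    rw [← this, ← Submodule.map_comap_subtype, Submodule.finrank_map_subtype_eq]
  have h3 := Finset.sum_congr (rfl : Sᶜ = Sᶜ) h2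
  rw [Finset.sum_add_distrib, Finset.sum_const, hcard, smul_eq_mul] at h3
  -- Rank-nullity over the p + 1 + q indices outside `S`, with total nullity at most q · dim, leaves
  -- total rank at least (p + 1) · dim.
  nlinarith

/-- Passing from `J` to its product with `V` does not decrease the average density. -/
theorem wedgeRank_succ_le_wedgeRank {J J' : Submodule K (ExteriorAlgebra K V)} {q : ℕ}
    (hJ : ∀ x ∈ J, ∀ v, x * ExteriorAlgebra.ι K v ∈ J') (hJ' : J' ≤ ⋀[K]^q V) (k : ℕ) :
    (k + 1) * wedgeRank b J (k + 1) ≤ q * wedgeRank b J' k := by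
  have : FiniteDimensional K (ExteriorAlgebra K V) := Module.Finite.of_basis b.ExteriorAlgebra
  rw [wedgeRank, wedgeRank, sum_powersetCard_succ, Finset.mul_sum]
  refine Finset.sum_le_sum fun S _ => le_trans (Finset.sum_le_sum fun i hi => ?_)
    (sum_finrank_inf_ker_mulRight_le b (wedgeBasis b J' S) S q
      (card_sdiff_le_of_repr_wedgeBasis_ne_zero b hJ'))
  exact Submodule.finrank_mono (wedgeBasis_insert_le b hJ (Finset.mem_compl.1 hi))

end Weight

/-! ### Ideals generated by top forms of subspaces -/

section Multiples

variable {K V : Type*} [Field K] [AddCommGroup V] [Module K V]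

/-- The span of the decomposable `q`-vectors whose supporting subspace contains a member of `s`,
i.e. the degree `q` part of the ideal generated by the top exterior powers of members of `s`. -/
noncomputable def wedgeMultiples (s : Set (Submodule K V)) (q : ℕ) :
    Submodule K (ExteriorAlgebra K V) :=
  Submodule.span K {x | ∃ w : Fin q → V, (∃ B ∈ s, B ≤ Submodule.span K (Set.range w)) ∧
    ExteriorAlgebra.ιMulti K q w = x}

theorem wedgeMultiples_mono {s t : Set (Submodule K V)} (h : s ⊆ t) (q : ℕ) :
    wedgeMultiples s q ≤ wedgeMultiples t q := by
  refine Submodule.span_mono ?_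
  rintro x ⟨w, ⟨B, hB, hw⟩, hx⟩
  exact ⟨w, ⟨B, h hB, hw⟩, hx⟩

theorem wedgeMultiples_le_exteriorPower (s : Set (Submodule K V)) (q : ℕ) :
    wedgeMultiples s q ≤ ⋀[K]^q V := by
  rw [wedgeMultiples, Submodule.span_le]
  rintro _ ⟨w, -, rfl⟩
  exact ExteriorAlgebra.ιMulti_range K q ⟨w, rfl⟩

theorem mul_ι_mem_wedgeMultiples_succ (s : Set (Submodule K V)) (q : ℕ) :
    ∀ x ∈ wedgeMultiples s q, ∀ v, x * ExteriorAlgebra.ι K v ∈ wedgeMultiples s (q + 1) := by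
  intro x hx v
  have h : wedgeMultiples s q ≤
      (wedgeMultiples s (q + 1)).comap (LinearMap.mulRight K (ExteriorAlgebra.ι K v)) := by
    rw [wedgeMultiples, Submodule.span_le]
    rintro _ ⟨w, ⟨B, hB, hw⟩, rfl⟩
    refine Submodule.subset_span ⟨Fin.append w ![v], ⟨B, hB, hw.trans (Submodule.span_mono ?_)⟩, ?_⟩
    · rintro _ ⟨j, rfl⟩
      exact ⟨Fin.castAdd 1 j, by simp⟩
    · rw [← ExteriorAlgebra.ιMulti_mul_ιMulti]
      simp
  exact h hx

theorem ιMulti_ne_zero_of_linearIndependent {n : ℕ} {v : Fin n → V} (hv : LinearIndependent K v) :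
    ExteriorAlgebra.ιMulti K n v ≠ 0 := by
  have h := (exteriorPower.ιMulti_family_linearIndependent_field (n := n) hv).ne_zero
    (Set.powersetCard.ofFinEmbEquiv (RelEmbedding.refl _))
  intro h0
  apply h
  apply Subtype.ext
  rw [exteriorPower.ιMulti_family_apply_coe, ExteriorAlgebra.ιMulti_family,
    Equiv.symm_apply_apply]
  exact h0

theorem ιMulti_mul_ιMulti_eq_zero {m n : ℕ} {v : Fin m → V} {w : Fin n → V}
    (h : Submodule.span K (Set.range v) ⊓ Submodule.span K (Set.range w) ≠ ⊥) :
    ExteriorAlgebra.ιMulti K m v * ExteriorAlgebra.ιMulti K n w = 0 := by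
  rw [ExteriorAlgebra.ιMulti_mul_ιMulti]
  refine AlternatingMap.map_linearDependent _ _ fun hli => h ?_
  have hli' := hli.comp _ finSumFinEquiv.injective
  rw [linearIndependent_sum] at hli'
  have h1 : (Fin.append v w ∘ finSumFinEquiv) ∘ Sum.inl = v := by ext; simp
  have h2 : (Fin.append v w ∘ finSumFinEquiv) ∘ Sum.inr = w := by ext; simp
  rw [h1, h2] at hli'
  exact hli'.2.2.eq_bot

theorem span_range_append {m n : ℕ} (v : Fin m → V) (w : Fin n → V) :
    Submodule.span K (Set.range (Fin.append v w)) =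
      Submodule.span K (Set.range v) ⊔ Submodule.span K (Set.range w) := by
  have h : Set.range (Fin.append v w) = Set.range v ∪ Set.range w := by
    have hsum : Fin.append v w ∘ finSumFinEquiv = Sum.elim v w := by
      ext x
      cases x <;> simp
    rw [← finSumFinEquiv.surjective.range_comp, hsum, Set.Sum.elim_range]
  rw [h, Submodule.span_union]

theorem span_range_coe_finBasis [FiniteDimensional K V] (A : Submodule K V) :
    Submodule.span K (Set.range fun j => (finBasis K A j : V)) = A := by
  have := congrArg (Submodule.map A.subtype) (finBasis K A).span_eq
  rw [Submodule.map_span, ← Set.range_comp, Submodule.map_top, Submodule.range_subtype] at this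
  exact this

end Multiples

/-! ### Normalised weights and the gain from one pair -/

section Weight

variable {K V : Type*} [Field K] [AddCommGroup V] [Module K V]
  (b : Basis (Fin (finrank K V)) K V)

/-- `(dim V)!` times the average density of the projections of `wedgeMultiples s q` to
`p + q`-dimensional quotients of `V` by basis vectors. -/
noncomputable def wedgeWeight (s : Set (Submodule K V)) (p q : ℕ) : ℕ :=
  wedgeRank b (wedgeMultiples s q) (finrank K V - p - q) *
    ((finrank K V - p - q).factorial * p.factorial * q.factorial)

theorem wedgeWeight_succ_left_le (s : Set (Submodule K V)) {p q : ℕ}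
    (h : p + 1 + q ≤ finrank K V) : wedgeWeight b s (p + 1) q ≤ wedgeWeight b s p q := by
  obtain ⟨k, hk⟩ := Nat.exists_eq_add_of_le h
  have h1 : finrank K V - (p + 1) - q = k := by omega
  have h2 : finrank K V - p - q = k + 1 := by omega
  rw [wedgeWeight, wedgeWeight, h1, h2, Nat.factorial_succ, Nat.factorial_succ]
  have := Nat.mul_le_mul_right (k.factorial * p.factorial * q.factorial)
    (wedgeRank_le_wedgeRank_succ b (wedgeMultiples_le_exteriorPower s q) (p := p) (k := k)
    (by rw [Fintype.card_fin, hk]))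
  linarith

theorem wedgeWeight_le_succ_right (s : Set (Submodule K V)) {p q : ℕ}
    (h : p + q + 1 ≤ finrank K V) : wedgeWeight b s p q ≤ wedgeWeight b s p (q + 1) := by
  obtain ⟨k, hk⟩ := Nat.exists_eq_add_of_le h
  have h1 : finrank K V - p - q = k + 1 := by omega
  have h2 : finrank K V - p - (q + 1) = k := by omega
  rw [wedgeWeight, wedgeWeight, h1, h2, Nat.factorial_succ, Nat.factorial_succ]
  have := Nat.mul_le_mul_right (k.factorial * p.factorial * q.factorial)
    (wedgeRank_succ_le_wedgeRank b (mul_ι_mem_wedgeMultiples_succ s q)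
      (wedgeMultiples_le_exteriorPower s (q + 1)) k)
  linarith

theorem wedgeWeight_anti_left (s : Set (Submodule K V)) {p p' q : ℕ} (hp : p ≤ p')
    (h : p' + q ≤ finrank K V) : wedgeWeight b s p' q ≤ wedgeWeight b s p q := by
  induction p', hp using Nat.le_induction with
  | base => exact le_rfl
  | succ n _ ih => exact (wedgeWeight_succ_left_le b s h).trans (ih (by omega))

theorem wedgeWeight_mono_right (s : Set (Submodule K V)) {p q q' : ℕ} (hq : q ≤ q')
    (h : p + q' ≤ finrank K V) : wedgeWeight b s p q ≤ wedgeWeight b s p q' := by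
  induction q', hq using Nat.le_induction with
  | base => exact le_rfl
  | succ n _ ih => exact (ih (by omega)).trans (wedgeWeight_le_succ_right b s (by omega))

variable [FiniteDimensional K V]

/-- Left multiplication by the top form α of `A` separates the two spaces: it kills everything built
from `t`, while α ∧ β ∧ b_S, with β the top form of `B`, is the wedge of a basis of `V`. -/
theorem finrank_wedgeBasis_wedgeMultiples_lt {A B : Submodule K V} {s t : Set (Submodule K V)}
    (hst : t ⊆ s) (hB : B ∈ s) (hA : ∀ B' ∈ t, A ⊓ B' ≠ ⊥) {S : Finset (Fin (finrank K V))}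
    (hcard : finrank K A + finrank K B + S.card = finrank K V)
    (hS : (A ⊔ B) ⊔ Submodule.span K (b '' S) = ⊤) :
    finrank K (wedgeBasis b (wedgeMultiples t (finrank K B)) S) <
      finrank K (wedgeBasis b (wedgeMultiples s (finrank K B)) S) := by
  have : FiniteDimensional K (ExteriorAlgebra K V) := Module.Finite.of_basis b.ExteriorAlgebra
  let α := ExteriorAlgebra.ιMulti K _ fun j => (finBasis K A j : V)
  let β := ExteriorAlgebra.ιMulti K _ fun j => (finBasis K B j : V)
  have hker : wedgeBasis b (wedgeMultiples t (finrank K B)) S ≤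
      LinearMap.ker (LinearMap.mulLeft K α) := by
    rw [wedgeBasis, Submodule.map_le_iff_le_comap, wedgeMultiples, Submodule.span_le]
    rintro _ ⟨w, ⟨B', hB', hw⟩, rfl⟩
    simp only [SetLike.mem_coe, Submodule.mem_comap, LinearMap.mem_ker, LinearMap.mulRight_apply,
      LinearMap.mulLeft_apply]
    rw [← mul_assoc, ιMulti_mul_ιMulti_eq_zero, zero_mul]
    rw [span_range_coe_finBasis]
    exact ne_bot_of_le_ne_bot (hA B' hB') (inf_le_inf_left _ hw)
  refine Submodule.finrank_lt_finrank_of_lt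
    (lt_of_le_of_ne (wedgeBasis_mono b (wedgeMultiples_mono hst _) S) fun heq => ?_)
  have hβ : β * b.ExteriorAlgebra S ∈ wedgeBasis b (wedgeMultiples s (finrank K B)) S :=
    ⟨β, Submodule.subset_span ⟨_, ⟨B, hB, (span_range_coe_finBasis B).ge⟩, rfl⟩, rfl⟩
  rw [← heq] at hβ
  have h0 : α * (β * b.ExteriorAlgebra S) = 0 := hker hβ
  rw [ExteriorAlgebra.basis_apply_ofCard b rfl, ExteriorAlgebra.ιMulti_family, ← mul_assoc,
    ExteriorAlgebra.ιMulti_mul_ιMulti, ExteriorAlgebra.ιMulti_mul_ιMulti] at h0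
  refine ιMulti_ne_zero_of_linearIndependent
    (linearIndependent_of_top_le_span_of_card_eq_finrank ?_ (by simpa using hcard)) h0
  rw [span_range_append, span_range_append, span_range_coe_finBasis, span_range_coe_finBasis, ← hS]
  refine sup_le_sup_left (Submodule.span_mono ?_) _
  rintro _ ⟨j, hj, rfl⟩
  obtain ⟨k, hk⟩ := (Set.powersetCard.mem_range_ofFinEmbEquiv_symm_iff_mem
    (Set.powersetCard.ofCard (s := S) rfl) j).2 hj
  exact ⟨k, by rw [Function.comp_apply, hk]⟩

theorem wedgeRank_wedgeMultiples_add_choose_le {A B : Submodule K V} {s t : Set (Submodule K V)}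
    (hst : t ⊆ s) (hB : B ∈ s) (hA : ∀ B' ∈ t, A ⊓ B' ≠ ⊥) {k : ℕ}
    (hk : finrank K A + finrank K B + k = finrank K V)
    (hb : ∀ S : Finset (Fin (finrank K V)), finrank K A + finrank K B + S.card = finrank K V →
      (A ⊔ B) ⊔ Submodule.span K (b '' S) = ⊤) :
    wedgeRank b (wedgeMultiples t (finrank K B)) k + (finrank K V).choose k ≤
      wedgeRank b (wedgeMultiples s (finrank K B)) k := by
  have h1 : (finrank K V).choose k =
      ∑ S ∈ (Finset.univ : Finset (Fin (finrank K V))).powersetCard k, 1 := by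
    simp
  rw [h1, wedgeRank, wedgeRank, ← Finset.sum_add_distrib]
  refine Finset.sum_le_sum fun S hS => ?_
  have hcard : finrank K A + finrank K B + S.card = finrank K V := by
    rw [(Finset.mem_powersetCard.1 hS).2, hk]
  exact finrank_wedgeBasis_wedgeMultiples_lt b hst hB hA hcard (hb S hcard)

theorem wedgeWeight_zero_finrank_le (s : Set (Submodule K V)) :
    wedgeWeight b s 0 (finrank K V) ≤ (finrank K V).factorial := by
  have : FiniteDimensional K (ExteriorAlgebra K V) := Module.Finite.of_basis b.ExteriorAlgebra
  have h : finrank K (wedgeBasis b (wedgeMultiples s (finrank K V)) ∅) ≤ 1 :=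
    calc _ ≤ finrank K (wedgeMultiples s (finrank K V)) := Submodule.finrank_map_le _ _
      _ ≤ finrank K (⋀[K]^(finrank K V) V) :=
        Submodule.finrank_mono (wedgeMultiples_le_exteriorPower _ _)
      _ = 1 := by rw [exteriorPower.finrank_eq, Nat.choose_self]
  simpa [wedgeWeight, wedgeRank] using Nat.mul_le_mul_right (finrank K V).factorial h

theorem wedgeWeight_add_le {A B : Submodule K V} {s t : Set (Submodule K V)}
    (hst : t ⊆ s) (hB : B ∈ s) (hA : ∀ B' ∈ t, A ⊓ B' ≠ ⊥)
    (hle : finrank K A + finrank K B ≤ finrank K V)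
    (hb : ∀ S : Finset (Fin (finrank K V)), finrank K A + finrank K B + S.card = finrank K V →
      (A ⊔ B) ⊔ Submodule.span K (b '' S) = ⊤) :
    ((finrank K V).factorial : ℝ) / ((finrank K A + finrank K B).choose (finrank K A)) +
        wedgeWeight b t (finrank K A) (finrank K B) ≤
      wedgeWeight b s (finrank K A) (finrank K B) := by
  obtain ⟨k, hk⟩ := Nat.exists_eq_add_of_le hle
  have h1 : finrank K V - finrank K A - finrank K B = k := by omega
  have h2 := wedgeRank_wedgeMultiples_add_choose_le b hst hB hA hk.symm hb
  rw [wedgeWeight, wedgeWeight, h1]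
  have h3 : ((finrank K V).factorial : ℝ) /
      ((finrank K A + finrank K B).choose (finrank K A)) = ((finrank K V).choose k *
        (k.factorial * (finrank K A).factorial * (finrank K B).factorial) : ℕ) := by
    rw [div_eq_iff (by exact_mod_cast (Nat.choose_pos (Nat.le_add_right _ _)).ne')]
    norm_cast
    have e1 := Nat.add_choose_mul_factorial_mul_factorial (finrank K A) (finrank K B)
    have e2 := Nat.choose_mul_factorial_mul_factorial (show k ≤ finrank K V by omega)
    rw [show finrank K V - k = finrank K A + finrank K B by omega, ← e1] at e2
    rw [← e2, Nat.choose_symm_add]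
    ring
  rw [h3]
  norm_cast
  rw [← add_mul, add_comm]
  exact Nat.mul_le_mul_right _ h2

end Weight

/-! ### The skew Bollobás inequality -/

theorem theorem3p5 {V : Type*} [AddCommGroup V] [Module ℝ V] [FiniteDimensional ℝ V]
    (m : ℕ) (A B : Fin m → Submodule ℝ V) (a b : Fin m → ℕ)
    (hA : ∀ i, A i ≠ ⊥) (hB : ∀ i, B i ≠ ⊥)
    (ha : ∀ i, Module.finrank ℝ (A i) = a i)
    (hb : ∀ i, Module.finrank ℝ (B i) = b i)
    (hdisj : ∀ i, A i ⊓ B i = ⊥)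
    (hskew : ∀ i j, i < j → A i ⊓ B j ≠ ⊥)
    (ha_mono : Monotone a) (hb_anti : Antitone b) :
    ∑ i, (1 : ℝ) / ((a i + b i).choose (a i) : ℝ) ≤ 1 := by
  obtain ⟨e, he⟩ := exists_basis_generalPosition fun i => A i ⊔ B i
  have hsup : ∀ i, finrank ℝ ↥(A i ⊔ B i) = finrank ℝ (A i) + finrank ℝ (B i) := fun i => by
    have := Submodule.finrank_sup_add_finrank_inf_eq (A i) (B i)
    rwa [hdisj, finrank_bot, add_zero] at this
  have hle : ∀ i, a i + b i ≤ finrank ℝ V := fun i => by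
    rw [← ha, ← hb, ← hsup]
    exact Submodule.finrank_le _
  let s : ℕ → Set (Submodule ℝ V) := fun i => B '' {j | i ≤ j}
  -- Downward induction on i. Leaving (p, q) free lets the bound at (a_{i+1}, b_{i+1}) be reused at
  -- (a_i, b_i), where the pair i is added.
  have key : ∀ d i : ℕ, i + d = m → ∀ p q, p + q ≤ finrank ℝ V →
      (∀ j : Fin m, i ≤ j → p ≤ a j ∧ b j ≤ q) →
      ∑ j ∈ Finset.univ.filter fun j : Fin m => i ≤ (j : ℕ), ((finrank ℝ V).factorial : ℝ) / ((a j + b j).choose (a j) : ℝ) ≤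
        wedgeWeight e (s i) p q := by
    intro d
    induction d with
    | zero =>
      intro i hi p q _ _
      rw [Finset.sum_eq_zero]
      · positivity
      · intro j hj
        have := (Finset.mem_filter.1 hj).2
        omega
    | succ d ih =>
      intro i hi p q hpq h
      let i' : Fin m := ⟨i, by omega⟩
      have hsplit : (Finset.univ.filter fun j : Fin m => i ≤ j) =
          insert i' (Finset.univ.filter fun j : Fin m => i + 1 ≤ j) := by
        ext j
        simp only [Finset.mem_filter, Finset.mem_univ, true_and, Finset.mem_insert, Fin.ext_iff, i']
        omega
      rw [hsplit, Finset.sum_insert (by simp [i'])]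
      have h1 := ih (i + 1) (by omega) (a i') (b i') (hle i') fun j hj =>
        have hij : i' ≤ j := Fin.le_def.2 (by simp only [i']; omega)
        ⟨ha_mono hij, hb_anti hij⟩
      have h2 := wedgeWeight_add_le e (A := A i') (B := B i') (s := s i) (t := s (i + 1))
        (Set.image_mono fun j hj => (Nat.le_succ i).trans hj)
        (Set.mem_image_of_mem _ (le_refl i))
        (by
          rintro _ ⟨j, hj, rfl⟩
          exact hskew _ _ (Fin.lt_def.2 hj))
        (by rw [ha, hb]; exact hle i')
        (fun S hS => he i' S (by rw [hsup, hS]))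
      rw [ha, hb] at h2
      obtain ⟨hp, hq⟩ := h i' le_rfl
      have h3 : wedgeWeight e (s i) (a i') (b i') ≤ wedgeWeight e (s i) p q :=
        (wedgeWeight_anti_left e _ hp (hle i')).trans (wedgeWeight_mono_right e _ hq hpq)
      have h4 : (wedgeWeight e (s i) (a i') (b i') : ℝ) ≤ wedgeWeight e (s i) p q := by
        exact_mod_cast h3
      linarith
  have h := key m 0 (by omega) 0 (finrank ℝ V) (by omega) fun j _ =>
    ⟨Nat.zero_le _, (Nat.le_add_left _ _).trans (hle j)⟩
  have h' : (wedgeWeight e (s 0) 0 (finrank ℝ V) : ℝ) ≤ (finrank ℝ V).factorial := by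
    exact_mod_cast wedgeWeight_zero_finrank_le e (s 0)
  have hpos : (0 : ℝ) < (finrank ℝ V).factorial := by positivity
  have h5 := h.trans h'
  simp only [Nat.zero_le, Finset.filter_true] at h5
  simp_rw [div_eq_mul_one_div ((finrank ℝ V).factorial : ℝ), ← Finset.mul_sum] at h5
  exact le_of_mul_le_mul_left (by rwa [mul_one]) hpos
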